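/- Let $\Gamma$ be a vector-valued normal-form game: finitely many players $i$, finite action sets $A_i$, joint actions $a\in\mathcal A=\prod_i A_i$, and utility features $u_i:\mathcal A\to V$ in a real Hilbert space $V$. Let $\Phi$ be a finite family of deviations. Each $f\in\Phi$ has instantaneous regret features $r_f:\mathcal A\to V$, with $r_f(a)=u_i(f(a))-u_i(a)$ if $f$ modifies the action of player $i$ by a map $A_i\to A_i$; more generally $r_f$ may be arbitrary. Put $r_f(p)=\sum_a p(a)\,r_f(a)$ for $p:\mathcal A\to\mathbb R$. For each $f\in\Phi$ let $\Phi_f\subseteq\Phi$ be non-empty, let $\sigma\in\Delta_{\mathcal A}$ be the true behavior, and put $\operatorname{Regret}_{\Phi_f}(\sigma\mid w)=\max_{g\in\Phi_f}\langle r_g(\sigma),w\rangle$. Let $K\subseteq V$ be a set, $K^*=\{x:\langle x,y\rangle\ge 0\ \forall y\in K\}$ and $K^{**}=(K^*)^*$. The maximum entropy ICE program is $$\max_{\hat\sigma,\eta}\ H(\hat\sigma)=-\sum_a\hat\sigma(a)\log\hat\sigma(a)\quad\text{s.t.}\quad r_f(\hat\sigma)-\sum_{g\in\Phi_f}\eta_f(g)\,r_g(\sigma)\in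 -K^*,\quad \eta_f\in\Delta_{\Phi_f}\ (\forall f\in\Phi),\quad \hat\sigma\in\Delta_{\mathcal A}.$$ The $\hat\sigma$-component of an optimal solution is called a maximum entropy ICE distribution. For $\theta=(\theta_f)_{f\in\Phi}\in V^\Phi$ let $$D(\theta)=\sum_{f\in\Phi}\operatorname{Regret}_{\Phi_f}(\sigma\mid\theta_f)+\log Z(\theta),\qquad Z(\theta)=\sum_{a\in\mathcal A}\exp\Bigl(-\sum_{f\in\Phi}\langle r_f(a),\theta_f\rangle\Bigr).$$ **Theorem.** 1. (Lagrange dual.) Introduce slacks $y_f\in K^*$, multipliers $\theta_f\in V$ for $r_f(\hat\sigma)-\sum_g\eta_f(g)r_g(\sigma)+y_f=0$, $\alpha_f\in\mathbb R$ for $\sum_g\eta_f(g)=1$, $\beta\in\mathbb R$ for $\sum_a\hat\sigma(a)=1$, $u\ge0$ for $\hat\sigma\ge0$, $v_f\ge0$ for $\eta_f\ge0$, and $x_f\in K^{**}$ for $y_f\in K^*$. The Lagrange dual function is the supremum over $\hat\sigma\ge0$ (the domain of $H$), $\eta$ and $y$ of $$H(\hat\sigma)+\sum_f\alpha_f\Bigl(1-\sum_g\eta_f(g)\Bigr)+\beta\Bigl(1-\sum_a\hat\sigma(a)\Bigr)-\sum_f\Bigl\langle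 r_f(\hat\sigma)-\sum_g\eta_f(g)r_g(\sigma)+y_f,\theta_f\Bigr\rangle+\sum_f\sum_g v_f(g)\eta_f(g)+\sum_a u(a)\hat\sigma(a)+\sum_f\langle y_f,x_f\rangle .$$ If $\theta_f\in K^{**}$ for all $f$, the minimum of the dual function over $\alpha,\beta,u\ge 0,v\ge 0,x\in (K^{**})^\Phi$ is attained and equals $D(\theta)$; for any other $\theta$ the dual function is $+\infty$ for all such $\alpha,\beta,u,v,x$. Thus the dual program is: minimize $D(\theta)$ subject to $\theta_f\in K^{**}$ for all $f\in\Phi$. 2. (Convexity.) The feasible set $(K^{**})^\Phi$ is convex, and $D$ is convex on it. 3. (Non-smoothness.) $D:V^\Phi\to\mathbb R$ fails to be differentiable everywhere if and only if some $\Phi_f$ contains $g,g'$ with $r_g(\sigma)\ne r_{g'}(\sigma)$; in that case it is not differentiable at the feasible point $\theta=0$. In particular $D$ is non-smooth in general: there is an instance with one player, two actions, $V=K=\mathbb R$, two deviations of the player, and $\Phi_f=\Phi$ for all $f$, for which $D$ is not differentiable at some feasible point. 4. (Strong duality.) The supremum of the maximum entropy ICE program equals the infimum of the dual program (both are $-\infty$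 if the maximum entropy program is infeasible). If $f\in\Phi_f$ for all $f\in\Phi$, the maximum entropy program is feasible. Whenever it is feasible, it has an optimal solution, and the maximum entropy ICE distribution is unique. 5. (Recovery.) If $\theta^*$ is an optimal solution of the dual program, then the unique maximum entropy ICE distribution is $$\hat\sigma(a)=\frac{1}{Z(\theta^*)}\exp\Bigl(-\sum_{f\in\Phi}\langle r_f(a),\theta^*_f\rangle\Bigr)\qquad(a\in\mathcal A).$$ -/

import Mathlib

open scoped RealInnerProductSpace Pointwise

noncomputable section

/-- A vector-valued normal-form game with player set `ι`, action sets `A i`, joint actions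
`∀ i, A i`, and utility features in `V`. -/
structure VectorGame (ι : Type*) (A : ι → Type*) (V : Type*) where
  /-- The utility feature function of each player. -/
  utility : ι → (∀ i, A i) → V

/-- A deviation in the game `Γ`: either a modification of the action of one player, or, more
generally, a strategy modification that is known only through its instantaneous regret
features. -/
inductive Deviation {ι : Type*} {A : ι → Type*} {V : Type*} (Γ : VectorGame ι A V) where
  | unilateral (i : ι) (φ : A i → A i) : Deviation Γ
  | general (r : (∀ i, A i) → V) : Deviation Γ

/-- Instantaneous regret features `r_f(a)`; for a deviation of player `i` this is
`u_i(f(a)) - u_i(a)`. -/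
def Deviation.regret {ι : Type*} [DecidableEq ι] {A : ι → Type*} {V : Type*} [AddCommGroup V]
    {Γ : VectorGame ι A V} : Deviation Γ → (∀ i, A i) → V
  | .unilateral i φ, a => Γ.utility i (Function.update a i (φ (a i))) - Γ.utility i a
  | .general r, a => r a

/-- Shannon entropy `-∑ a, p a * log (p a)`, with `0 log 0 = 0`; used for `p ≥ 0` only. -/
def shannonEntropy {α : Type*} [Fintype α] (p : α → ℝ) : ℝ := ∑ a, Real.negMulLog (p a)

/-- The data of a maximum entropy ICE program: a game, a finite family of deviations indexed by
`Φ`, for every `f` the non-empty set `Φ_f` of deviations that `f` is compared with, the true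
behavior `σ`, and the set `K` of utility vectors. -/
structure ICEProblem (ι : Type*) [Fintype ι] [DecidableEq ι] (A : ι → Type*)
    [∀ i, Fintype (A i)] (V : Type*) [NormedAddCommGroup V] [InnerProductSpace ℝ V]
    (Φ : Type*) [Fintype Φ] where
  game : VectorGame ι A V
  dev : Φ → Deviation game
  cmp : Φ → Finset Φ
  cmp_nonempty : ∀ f, (cmp f).Nonempty
  σ : (∀ i, A i) → ℝ
  σ_mem : σ ∈ stdSimplex ℝ (∀ i, A i)
  K : Set V

namespace ICEProblem

variable {ι : Type*} [Fintype ι] [DecidableEq ι] {A : ι → Type*} [∀ i, Fintype (A i)]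
  {V : Type*} [NormedAddCommGroup V] [InnerProductSpace ℝ V] [CompleteSpace V]
  {Φ : Type*} [Fintype Φ]

/-- `r_f(a)`. -/
def r (P : ICEProblem ι A V Φ) (f : Φ) (a : ∀ i, A i) : V := (P.dev f).regret a

/-- Expected regret features `r_f(p) = ∑ a, p(a) r_f(a)`. -/
def expRegret (P : ICEProblem ι A V Φ) (f : Φ) (p : (∀ i, A i) → ℝ) : V := ∑ a, p a • P.r f a

/-- `Regret_{Φ_f}(p | w) = max_{g ∈ Φ_f} ⟪r_g(p), w⟫`. -/
def maxRegret (P : ICEProblem ι A V Φ) (f : Φ) (p : (∀ i, A i) → ℝ) (w : V) : ℝ :=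
  (P.cmp f).sup' (P.cmp_nonempty f) fun g => ⟪P.expRegret g p, w⟫

/-- The dual cone `K*`. -/
def dualCone (P : ICEProblem ι A V Φ) : Set V := (ProperCone.innerDual P.K : Set V)

/-- The bidual cone `K**`. -/
def bidualCone (P : ICEProblem ι A V Φ) : Set V := (ProperCone.innerDual P.dualCone : Set V)

/-- `E_{g ∼ η_f} [r_g(σ)]`, for a weight `η_f` on `Φ_f`. -/
def comparison (P : ICEProblem ι A V Φ) (f : Φ) (ηf : P.cmp f → ℝ) : V :=
  ∑ g : P.cmp f, ηf g • P.expRegret g P.σ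

/-! ### The primal program -/

/-- The feasible set of the primal program, that is, the `K`-ICE polytope: the pairs `(p, η)` with
`p` a joint strategy, `η_f` a distribution on `Φ_f`, and
`r_f(p) - E_{g ∼ η_f} [r_g(σ)] ∈ -K*` for all `f`. -/
def primalFeasible (P : ICEProblem ι A V Φ) :
    Set (((∀ i, A i) → ℝ) × (∀ f, P.cmp f → ℝ)) :=
  {x | x.1 ∈ stdSimplex ℝ (∀ i, A i) ∧ (∀ f, x.2 f ∈ stdSimplex ℝ (P.cmp f)) ∧
    ∀ f, P.expRegret f x.1 - P.comparison f (x.2 f) ∈ -P.dualCone}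

/-- The optimal value of the primal program (`⊥` if it is infeasible). -/
def primalValue (P : ICEProblem ι A V Φ) : EReal :=
  ⨆ x ∈ P.primalFeasible, ((shannonEntropy x.1 : ℝ) : EReal)

/-- `p` is a maximum entropy ICE distribution: the strategy component of an optimal solution of
the primal program. -/
def IsMaxEnt (P : ICEProblem ι A V Φ) (p : (∀ i, A i) → ℝ) : Prop :=
  ∃ η, (p, η) ∈ P.primalFeasible ∧ ∀ x ∈ P.primalFeasible, shannonEntropy x.1 ≤ shannonEntropy p

/-! ### The Lagrangian and the Lagrange dual function

The primal program is taken in the equality form with slacks `y_f`: maximize the entropy of `p`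
subject to `r_f(p) - E_{g ∼ η_f} [r_g(σ)] + y_f = 0`, `∑ η_f = 1`, `∑ p = 1`, `p ≥ 0`, `η ≥ 0`,
`y_f ∈ K*`. -/

/-- Lagrange multipliers: `θ_f` for `r_f(p) - E_{η_f} + y_f = 0`, `α_f` for `∑ η_f = 1`, `β` for
`∑ p = 1`, `u` for `p ≥ 0`, `v_f` for `η_f ≥ 0`, and `x_f` for `y_f ∈ K*`. -/
structure Multipliers (P : ICEProblem ι A V Φ) where
  θ : Φ → V
  α : Φ → ℝ
  β : ℝ
  u : (∀ i, A i) → ℝ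
  v : ∀ f, P.cmp f → ℝ
  x : Φ → V

/-- Admissible multipliers: those of inequality constraints are nonnegative, those of the
constraints `y_f ∈ K*` lie in the dual cone `K**` of `K*`. -/
def Multipliers.Admissible {P : ICEProblem ι A V Φ} (m : P.Multipliers) : Prop :=
  (∀ a, 0 ≤ m.u a) ∧ (∀ f g, 0 ≤ m.v f g) ∧ ∀ f, m.x f ∈ P.bidualCone

/-- The Lagrangian of the primal program. -/
def lagrangian (P : ICEProblem ι A V Φ) (p : (∀ i, A i) → ℝ) (η : ∀ f, P.cmp f → ℝ) (y : Φ → V)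
    (m : P.Multipliers) : ℝ :=
  shannonEntropy p
    + ∑ f, m.α f * (1 - ∑ g, η f g)
    + m.β * (1 - ∑ a, p a)
    - ∑ f, ⟪P.expRegret f p - P.comparison f (η f) + y f, m.θ f⟫
    + ∑ f, ∑ g, m.v f g * η f g
    + ∑ a, m.u a * p a
    + ∑ f, ⟪y f, m.x f⟫

/-- The Lagrange dual function: the supremum of the Lagrangian over all primal variables
`p, η, y`, where `p` ranges over the domain `{p | 0 ≤ p}` of the entropy and `η`, `y` are free. -/
def lagrangeDual (P : ICEProblem ι A V Φ) (m : P.Multipliers) : EReal :=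
  ⨆ (p : (∀ i, A i) → ℝ) (_ : ∀ a, 0 ≤ p a) (η : ∀ f, P.cmp f → ℝ) (y : Φ → V),
    ((P.lagrangian p η y m : ℝ) : EReal)

/-! ### The dual program -/

/-- The score `∑ f, r_f(a | θ_f)`. -/
def score (P : ICEProblem ι A V Φ) (θ : Φ → V) (a : ∀ i, A i) : ℝ := ∑ f, ⟪P.r f a, θ f⟫

/-- The partition function `Z(θ)`. -/
def Z (P : ICEProblem ι A V Φ) (θ : Φ → V) : ℝ := ∑ a, Real.exp (-P.score θ a)

/-- The feasible set of the dual program: `θ_f ∈ K**` for all `f`. -/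
def dualFeasible (P : ICEProblem ι A V Φ) : Set (Φ → V) := {θ | ∀ f, θ f ∈ P.bidualCone}

/-- The dual objective `∑ f, Regret_{Φ_f}(σ | θ_f) + log Z(θ)`. -/
def dualObjective (P : ICEProblem ι A V Φ) (θ : Φ → V) : ℝ :=
  ∑ f, P.maxRegret f P.σ (θ f) + Real.log (P.Z θ)

/-- The optimal value of the dual program. -/
def dualValue (P : ICEProblem ι A V Φ) : EReal :=
  ⨅ θ ∈ P.dualFeasible, ((P.dualObjective θ : ℝ) : EReal)

/-- `θ` is an optimal solution of the dual program. -/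
def IsDualOptimal (P : ICEProblem ι A V Φ) (θ : Φ → V) : Prop :=
  θ ∈ P.dualFeasible ∧ ∀ θ' ∈ P.dualFeasible, P.dualObjective θ ≤ P.dualObjective θ'

end ICEProblem

end

open scoped RealInnerProductSpace Pointwise

noncomputable section

/-! ### Entropy and the Gibbs variational principle -/

/-! Keep `p` and all `η_f` in their simplices and relax only the rationality constraints, with
prices `θ_f ∈ K**`. The resulting `partialLagrangian` is concave in `x = (p, η)` and affine in `θ`.
It splits into entropy minus energy, whose maximum is `log Z` by the Gibbs principle, and one linear
function of each `η_f`, whose maximum is the regret. So `D(θ) = max_x L(x, θ)`, and `D` is convex.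

For fixed `x`, the infimum of `L` over feasible `θ` is the entropy if `x` is feasible and `-∞`
otherwise. Sion's theorem, with compactness only on the side of `x`, exchanges inf and sup; this is
strong duality without a Slater condition. At a dual optimum, weak duality is an equality, and the
equality case of Gibbs identifies `p`.

In the full Lagrangian the free slack `y` forces `x_f = θ_f`, and explicit `α, β, v` attain `D(θ)`.
Non-smoothness comes from the regret part, which is positively homogeneous, hence differentiable at
`0` only if linear. -/

theorem negMulLog_sub_mul_le_exp {x : ℝ} (hx : 0 ≤ x) (c : ℝ) :
    Real.negMulLog x - c * x ≤ Real.exp (-1 - c) ∧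
      (Real.negMulLog x - c * x = Real.exp (-1 - c) → x = Real.exp (-1 - c)) := by
  set q := Real.exp (-1 - c) with hq
  have hq0 : 0 < q := Real.exp_pos _
  -- `q` is the maximizer; rescaling by it reduces the claim to `-t log t ≤ 1 - t`, with equality
  -- only at `t = 1`.
  obtain ⟨t, rfl⟩ : ∃ t, x = q * t := ⟨x / q, by field_simp⟩
  have ht : 0 ≤ t := nonneg_of_mul_nonneg_right hx hq0
  have hval : Real.negMulLog (q * t) - c * (q * t) = q * (t + Real.negMulLog t) := by
    rw [Real.negMulLog_mul]
    have : Real.negMulLog q = q * (1 + c) := by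
      rw [Real.negMulLog, hq, Real.log_exp]; ring
    rw [this]; ring
  rw [hval]
  constructor
  · have := Real.negMulLog_le_one_sub_self ht
    nlinarith
  · intro h
    by_contra hne
    have ht1 : t ≠ 1 := fun h1 => hne (by rw [h1, mul_one])
    have := Real.negMulLog_lt_one_sub_self ht ht1
    nlinarith

section Gibbs

variable {α : Type*} [Fintype α]

theorem continuous_shannonEntropy : Continuous (shannonEntropy : (α → ℝ) → ℝ) := by
  unfold shannonEntropy
  fun_prop

theorem strictConcaveOn_shannonEntropy :
    StrictConcaveOn ℝ {p : α → ℝ | ∀ a, 0 ≤ p a} shannonEntropy := by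
  refine ⟨fun p hp q hq s t hs ht _ a => ?_, fun p hp q hq hne s t hs ht hst => ?_⟩
  · exact add_nonneg (mul_nonneg hs (hp a)) (mul_nonneg ht (hq a))
  · obtain ⟨a, ha⟩ := Function.ne_iff.1 hne
    simp only [shannonEntropy, smul_eq_mul, Finset.mul_sum, ← Finset.sum_add_distrib]
    exact Finset.sum_lt_sum
      (fun b _ => Real.concaveOn_negMulLog.2 (hp b) (hq b) hs.le ht.le hst)
      ⟨a, Finset.mem_univ a, Real.strictConcaveOn_negMulLog.2 (hp a) (hq a) ha hs ht hst⟩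

/-- The Gibbs distribution with energy `s`. -/
def gibbs (s : α → ℝ) (a : α) : ℝ := Real.exp (-s a) / ∑ b, Real.exp (-s b)

/-- Normalization lets the constant `log Z - 1` be absorbed into the coefficients of `p a`, so that
each coordinate can be maximized separately. The shift by `-1` makes the separate maximizers the
Gibbs weights. -/
theorem entropy_sub_energy_eq (s p : α → ℝ) (hp : ∑ a, p a = 1) :
    shannonEntropy p - ∑ a, p a * s a =
      ∑ a, (Real.negMulLog (p a) - (Real.log (∑ b, Real.exp (-s b)) - 1 + s a) * p a)
        + (Real.log (∑ b, Real.exp (-s b)) - 1) := by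
  have : ∑ a, (Real.log (∑ b, Real.exp (-s b)) - 1 + s a) * p a
      = (Real.log (∑ b, Real.exp (-s b)) - 1) + ∑ a, p a * s a := by
    simp only [add_mul, Finset.sum_add_distrib, ← Finset.mul_sum, hp, mul_one]
    simp only [mul_comm]
  rw [Finset.sum_sub_distrib, this, shannonEntropy]
  ring

variable [Nonempty α]

theorem sum_exp_neg_pos (s : α → ℝ) : 0 < ∑ b, Real.exp (-s b) :=
  Finset.sum_pos (fun _ _ => Real.exp_pos _) Finset.univ_nonempty

theorem gibbs_mem_stdSimplex (s : α → ℝ) : gibbs s ∈ stdSimplex ℝ α :=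
  ⟨fun _ => div_nonneg (Real.exp_pos _).le (sum_exp_neg_pos s).le, by
    simp only [gibbs]
    rw [← Finset.sum_div, div_self (sum_exp_neg_pos s).ne']⟩

theorem exp_neg_one_sub_eq_gibbs (s : α → ℝ) (a : α) :
    Real.exp (-1 - (Real.log (∑ b, Real.exp (-s b)) - 1 + s a)) = gibbs s a := by
  rw [show -1 - (Real.log (∑ b, Real.exp (-s b)) - 1 + s a)
    = -s a - Real.log (∑ b, Real.exp (-s b)) by ring, Real.exp_sub,
    Real.exp_log (sum_exp_neg_pos s), gibbs]

/-- The bound avoids normalization of `p`, because the Lagrange dual function ranges over the whole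
orthant. -/
theorem sum_negMulLog_sub_le (s : α → ℝ) {p : α → ℝ} (hp : ∀ a, 0 ≤ p a) :
    ∑ a, (Real.negMulLog (p a) - (Real.log (∑ b, Real.exp (-s b)) - 1 + s a) * p a) ≤ 1 := by
  refine (Finset.sum_le_sum fun a _ => ?_).trans_eq (gibbs_mem_stdSimplex s).2
  rw [← exp_neg_one_sub_eq_gibbs]
  exact (negMulLog_sub_mul_le_exp (hp a) _).1

theorem entropy_sub_energy_le (s : α → ℝ) {p : α → ℝ} (hp : p ∈ stdSimplex ℝ α) :
    shannonEntropy p - ∑ a, p a * s a ≤ Real.log (∑ b, Real.exp (-s b)) := by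
  rw [entropy_sub_energy_eq s p hp.2]
  linarith [sum_negMulLog_sub_le s hp.1]

theorem eq_gibbs_of_le_entropy_sub_energy (s : α → ℝ) {p : α → ℝ} (hp : p ∈ stdSimplex ℝ α)
    (h : Real.log (∑ b, Real.exp (-s b)) ≤ shannonEntropy p - ∑ a, p a * s a) : p = gibbs s := by
  rw [entropy_sub_energy_eq s p hp.2] at h
  have hle : ∀ a ∈ Finset.univ,
      Real.negMulLog (p a) - (Real.log (∑ b, Real.exp (-s b)) - 1 + s a) * p a ≤ gibbs s a := by
    intro a _
    rw [← exp_neg_one_sub_eq_gibbs]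
    exact (negMulLog_sub_mul_le_exp (hp.1 a) _).1
  -- Termwise bounds whose sums agree are equalities term by term.
  have hsum := (Finset.sum_eq_sum_iff_of_le hle).1
    (le_antisymm (Finset.sum_le_sum hle) (by rw [(gibbs_mem_stdSimplex s).2]; linarith))
  funext a
  have ha := hsum a (Finset.mem_univ a)
  rw [← exp_neg_one_sub_eq_gibbs] at ha ⊢
  exact (negMulLog_sub_mul_le_exp (hp.1 a) _).2 ha

theorem entropy_gibbs_sub_energy (s : α → ℝ) :
    shannonEntropy (gibbs s) - ∑ a, gibbs s a * s a = Real.log (∑ b, Real.exp (-s b)) := by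
  have hZ := sum_exp_neg_pos s
  rw [shannonEntropy, ← Finset.sum_sub_distrib]
  have : ∀ a, Real.negMulLog (gibbs s a) - gibbs s a * s a
      = gibbs s a * Real.log (∑ b, Real.exp (-s b)) := by
    intro a
    have hlog : Real.log (gibbs s a) = -s a - Real.log (∑ b, Real.exp (-s b)) := by
      rw [gibbs, Real.log_div (Real.exp_pos _).ne' hZ.ne', Real.log_exp]
    rw [Real.negMulLog, hlog]
    ring
  simp only [this]
  rw [← Finset.sum_mul, (gibbs_mem_stdSimplex s).2, one_mul]

end Gibbs

/-! ### Finite maxima as maxima of linear functions on a simplex. -/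

theorem sum_mul_le_sup' {β : Type*} (S : Finset β) (hS : S.Nonempty) (c : β → ℝ)
    {η : S → ℝ} (hη : η ∈ stdSimplex ℝ S) : ∑ g : S, η g * c g ≤ S.sup' hS c := by
  calc ∑ g : S, η g * c g ≤ ∑ g : S, η g * S.sup' hS c :=
        Finset.sum_le_sum fun g _ =>
          mul_le_mul_of_nonneg_left (Finset.le_sup' c g.2) (hη.1 g)
    _ = S.sup' hS c := by rw [← Finset.sum_mul, hη.2, one_mul]

theorem exists_sum_mul_eq_sup' {β : Type*} (S : Finset β) (hS : S.Nonempty) (c : β → ℝ) :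
    ∃ η ∈ stdSimplex ℝ S, ∑ g : S, η g * c g = S.sup' hS c := by
  classical
  obtain ⟨g, hg, h⟩ := Finset.exists_mem_eq_sup' hS c
  refine ⟨Pi.single ⟨g, hg⟩ 1, single_mem_stdSimplex ℝ _, ?_⟩
  rw [h, Finset.sum_eq_single ⟨g, hg⟩]
  · simp
  · intro b _ hb
    simp [hb]
  · simp

/-! ### The Lagrangian with only the rationality constraints relaxed. -/

namespace ICEProblem

variable {ι : Type*} [Fintype ι] [DecidableEq ι] {A : ι → Type*} [∀ i, Fintype (A i)]
  {V : Type*} [NormedAddCommGroup V] [InnerProductSpace ℝ V] {Φ : Type*} [Fintype Φ]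

theorem nonempty_action (P : ICEProblem ι A V Φ) : Nonempty (∀ i, A i) := by
  by_contra h
  have := not_nonempty_iff.1 h
  simpa using P.σ_mem.2

/-- The pairs `(p, η)` of distributions, without the rationality constraints. -/
def strategies (P : ICEProblem ι A V Φ) : Set (((∀ i, A i) → ℝ) × (∀ f, P.cmp f → ℝ)) :=
  stdSimplex ℝ (∀ i, A i) ×ˢ Set.univ.pi fun f => stdSimplex ℝ (P.cmp f)

theorem mem_strategies {P : ICEProblem ι A V Φ} {x : ((∀ i, A i) → ℝ) × (∀ f, P.cmp f → ℝ)} :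
    x ∈ P.strategies ↔
      x.1 ∈ stdSimplex ℝ (∀ i, A i) ∧ ∀ f, x.2 f ∈ stdSimplex ℝ (P.cmp f) := by
  simp [strategies, Set.mem_prod, Set.mem_pi]

theorem isCompact_strategies (P : ICEProblem ι A V Φ) : IsCompact P.strategies :=
  (isCompact_stdSimplex ℝ _).prod (isCompact_univ_pi fun _ => isCompact_stdSimplex ℝ _)

theorem convex_strategies (P : ICEProblem ι A V Φ) : Convex ℝ P.strategies :=
  (convex_stdSimplex ℝ _).prod (convex_pi fun _ _ => convex_stdSimplex ℝ _)

/-- The violation `r_f(p) - E_{g ∼ η_f} [r_g(σ)]`. -/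
def violation (P : ICEProblem ι A V Φ) (x : ((∀ i, A i) → ℝ) × (∀ f, P.cmp f → ℝ)) (f : Φ) : V :=
  P.expRegret f x.1 - P.comparison f (x.2 f)

/-- The Lagrangian in which only the rationality constraints are relaxed. -/
def partialLagrangian (P : ICEProblem ι A V Φ)
    (x : ((∀ i, A i) → ℝ) × (∀ f, P.cmp f → ℝ)) (θ : Φ → V) : ℝ :=
  shannonEntropy x.1 - ∑ f, ⟪P.violation x f, θ f⟫

theorem continuous_violation (P : ICEProblem ι A V Φ) (f : Φ) :
    Continuous fun x => P.violation x f := by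
  unfold violation expRegret comparison
  fun_prop

theorem violation_combo (P : ICEProblem ι A V Φ)
    (x y : ((∀ i, A i) → ℝ) × (∀ f, P.cmp f → ℝ)) (s t : ℝ) (f : Φ) :
    P.violation (s • x + t • y) f = s • P.violation x f + t • P.violation y f := by
  simp only [violation, expRegret, comparison, Prod.fst_add, Prod.smul_fst, Prod.snd_add,
    Prod.smul_snd, Pi.add_apply, Pi.smul_apply, smul_eq_mul, add_smul, mul_smul,
    Finset.sum_add_distrib, ← Finset.smul_sum, smul_sub]
  abel

theorem inner_expRegret (P : ICEProblem ι A V Φ) (f : Φ) (p : (∀ i, A i) → ℝ) (w : V) :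
    ⟪P.expRegret f p, w⟫ = ∑ a, p a * ⟪P.r f a, w⟫ := by
  simp [expRegret, sum_inner, real_inner_smul_left]

theorem inner_comparison (P : ICEProblem ι A V Φ) (f : Φ) (η : P.cmp f → ℝ) (w : V) :
    ⟪P.comparison f η, w⟫ = ∑ g : P.cmp f, η g * ⟪P.expRegret g P.σ, w⟫ := by
  simp [comparison, sum_inner, real_inner_smul_left]

theorem sum_inner_expRegret (P : ICEProblem ι A V Φ) (p : (∀ i, A i) → ℝ) (θ : Φ → V) :
    ∑ f, ⟪P.expRegret f p, θ f⟫ = ∑ a, p a * P.score θ a := by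
  simp only [inner_expRegret, score, Finset.mul_sum]
  exact Finset.sum_comm

/-- The variables `p` and `η_f` separate, so the maximum over the product of simplices can be taken
factor by factor. -/
theorem partialLagrangian_eq (P : ICEProblem ι A V Φ)
    (x : ((∀ i, A i) → ℝ) × (∀ f, P.cmp f → ℝ)) (θ : Φ → V) :
    P.partialLagrangian x θ = (shannonEntropy x.1 - ∑ a, x.1 a * P.score θ a)
      + ∑ f, ∑ g : P.cmp f, x.2 f g * ⟪P.expRegret g P.σ, θ f⟫ := by
  simp only [partialLagrangian, violation, inner_sub_left, Finset.sum_sub_distrib,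
    sum_inner_expRegret, inner_comparison]
  ring

theorem sum_comparison_le (P : ICEProblem ι A V Φ)
    {x : ((∀ i, A i) → ℝ) × (∀ f, P.cmp f → ℝ)} (hx : x ∈ P.strategies) (θ : Φ → V) :
    ∑ f, ∑ g : P.cmp f, x.2 f g * ⟪P.expRegret g P.σ, θ f⟫ ≤ ∑ f, P.maxRegret f P.σ (θ f) :=
  Finset.sum_le_sum fun f _ =>
    sum_mul_le_sup' (P.cmp f) (P.cmp_nonempty f) (fun g => ⟪P.expRegret g P.σ, θ f⟫)
      ((mem_strategies.1 hx).2 f)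

theorem partialLagrangian_le (P : ICEProblem ι A V Φ)
    {x : ((∀ i, A i) → ℝ) × (∀ f, P.cmp f → ℝ)} (hx : x ∈ P.strategies) (θ : Φ → V) :
    P.partialLagrangian x θ ≤ P.dualObjective θ := by
  have := P.nonempty_action
  rw [partialLagrangian_eq, dualObjective, Z]
  linarith [P.sum_comparison_le hx θ, entropy_sub_energy_le (P.score θ) (mem_strategies.1 hx).1]

theorem eq_gibbs_of_dualObjective_le (P : ICEProblem ι A V Φ)
    {x : ((∀ i, A i) → ℝ) × (∀ f, P.cmp f → ℝ)} (hx : x ∈ P.strategies) {θ : Φ → V}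
    (h : P.dualObjective θ ≤ P.partialLagrangian x θ) : x.1 = gibbs (P.score θ) := by
  have := P.nonempty_action
  rw [partialLagrangian_eq, dualObjective, Z] at h
  refine eq_gibbs_of_le_entropy_sub_energy _ (mem_strategies.1 hx).1 ?_
  linarith [P.sum_comparison_le hx θ]

/-- The Gibbs distribution and point masses at regret maximizers are optimal. With
`partialLagrangian_le`, this exhibits the dual objective as a maximum over `strategies`. -/
theorem exists_partialLagrangian_eq (P : ICEProblem ι A V Φ) (θ : Φ → V) :
    ∃ x ∈ P.strategies, P.partialLagrangian x θ = P.dualObjective θ := by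
  have := P.nonempty_action
  choose η hη h using fun f => exists_sum_mul_eq_sup' (P.cmp f) (P.cmp_nonempty f)
    fun g => ⟪P.expRegret g P.σ, θ f⟫
  refine ⟨(gibbs (P.score θ), η), mem_strategies.2 ⟨gibbs_mem_stdSimplex _, hη⟩, ?_⟩
  rw [partialLagrangian_eq, entropy_gibbs_sub_energy, dualObjective, Z, add_comm]
  congr 1
  exact Finset.sum_congr rfl fun f _ => h f

theorem partialLagrangian_combo (P : ICEProblem ι A V Φ)
    (x : ((∀ i, A i) → ℝ) × (∀ f, P.cmp f → ℝ)) (θ θ' : Φ → V) {s t : ℝ} (hst : s + t = 1) :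
    P.partialLagrangian x (s • θ + t • θ')
      = s * P.partialLagrangian x θ + t * P.partialLagrangian x θ' := by
  simp only [partialLagrangian, Pi.add_apply, Pi.smul_apply, inner_add_right,
    real_inner_smul_right, Finset.sum_add_distrib, ← Finset.mul_sum]
  linear_combination (-shannonEntropy x.1) * hst

theorem continuous_partialLagrangian_left (P : ICEProblem ι A V Φ) (θ : Φ → V) :
    Continuous fun x => P.partialLagrangian x θ := by
  have := P.continuous_violation
  have := continuous_shannonEntropy (α := ∀ i, A i)
  unfold partialLagrangian
  fun_prop

theorem continuous_partialLagrangian_right (P : ICEProblem ι A V Φ)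
    (x : ((∀ i, A i) → ℝ) × (∀ f, P.cmp f → ℝ)) : Continuous (P.partialLagrangian x) := by
  unfold partialLagrangian
  fun_prop

theorem concaveOn_partialLagrangian_left (P : ICEProblem ι A V Φ) (θ : Φ → V) :
    ConcaveOn ℝ P.strategies fun x => P.partialLagrangian x θ := by
  refine ⟨P.convex_strategies, fun x hx y hy s t hs ht hst => ?_⟩
  have := strictConcaveOn_shannonEntropy.concaveOn.2 (mem_strategies.1 hx).1.1
    (mem_strategies.1 hy).1.1 hs ht hst
  simp only [smul_eq_mul] at this
  simp only [partialLagrangian, violation_combo, inner_add_left, real_inner_smul_left,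
    Finset.sum_add_distrib, ← Finset.mul_sum, smul_eq_mul, Prod.fst_add, Prod.smul_fst]
  linarith

theorem strategies_nonempty (P : ICEProblem ι A V Φ) : P.strategies.Nonempty :=
  let ⟨x, hx, _⟩ := P.exists_partialLagrangian_eq 0
  ⟨x, hx⟩

/-! ### Convexity of the dual program -/

/-- A pointwise maximum of affine functions of `θ` is convex: evaluate at the maximizer for the
convex combination. -/
theorem convexOn_dualObjective_univ (P : ICEProblem ι A V Φ) :
    ConvexOn ℝ Set.univ P.dualObjective := by
  refine ⟨convex_univ, fun θ _ θ' _ s t hs ht hst => ?_⟩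
  obtain ⟨x, hx, h⟩ := P.exists_partialLagrangian_eq (s • θ + t • θ')
  rw [← h, partialLagrangian_combo P x θ θ' hst, smul_eq_mul, smul_eq_mul]
  gcongr <;> exact P.partialLagrangian_le hx _

/-! ### The Lagrangian -/

/-- All dependence on the slack is collected in the linear term `⟪y f, m.x f - m.θ f⟫`, which
vanishes if `m.x = m.θ`. -/
theorem lagrangian_eq (P : ICEProblem ι A V Φ) (p : (∀ i, A i) → ℝ) (η : ∀ f, P.cmp f → ℝ)
    (y : Φ → V) (m : P.Multipliers) :
    P.lagrangian p η y m = P.partialLagrangian (p, η) m.θ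
      + ∑ f, m.α f * (1 - ∑ g, η f g) + m.β * (1 - ∑ a, p a)
      + ∑ f, ∑ g, m.v f g * η f g + ∑ a, m.u a * p a + ∑ f, ⟪y f, m.x f - m.θ f⟫ := by
  simp only [lagrangian, partialLagrangian, violation, inner_add_left, inner_sub_right,
    Finset.sum_add_distrib, Finset.sum_sub_distrib]
  ring

theorem lagrangian_le_lagrangeDual (P : ICEProblem ι A V Φ) {p : (∀ i, A i) → ℝ}
    (hp : ∀ a, 0 ≤ p a) (η : ∀ f, P.cmp f → ℝ) (y : Φ → V) (m : P.Multipliers) :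
    ((P.lagrangian p η y m : ℝ) : EReal) ≤ P.lagrangeDual m :=
  le_iSup_of_le p <| le_iSup_of_le hp <| le_iSup_of_le η <| le_iSup_of_le y le_rfl

/-- Multipliers at which the Lagrange dual function attains the dual objective. -/
def optimalMultipliers (P : ICEProblem ι A V Φ) (θ : Φ → V) : P.Multipliers where
  θ := θ
  α f := P.maxRegret f P.σ (θ f)
  β := Real.log (P.Z θ) - 1
  u := 0
  v f g := P.maxRegret f P.σ (θ f) - ⟪P.expRegret g P.σ, θ f⟫
  x := θ

/-- Here `y` drops out, and `v` is chosen so that every coefficient of `η` cancels, leaving the sum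
of the `α f`. What remains is the Gibbs bound on the orthant with `β = log Z - 1`. -/
theorem lagrangian_optimalMultipliers_le (P : ICEProblem ι A V Φ) (θ : Φ → V)
    {p : (∀ i, A i) → ℝ} (hp : ∀ a, 0 ≤ p a) (η : ∀ f, P.cmp f → ℝ) (y : Φ → V) :
    P.lagrangian p η y (P.optimalMultipliers θ) ≤ P.dualObjective θ := by
  have := P.nonempty_action
  have key := sum_negMulLog_sub_le (P.score θ) hp
  rw [Finset.sum_sub_distrib] at key
  have h1 : ∑ a, (Real.log (∑ b, Real.exp (-P.score θ b)) - 1 + P.score θ a) * p a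
      = (Real.log (P.Z θ) - 1) * ∑ a, p a + ∑ a, p a * P.score θ a := by
    simp only [add_mul, Finset.sum_add_distrib, ← Finset.mul_sum, Z]
    simp only [mul_comm]
  have h2 : ∑ f, P.maxRegret f P.σ (θ f) * (1 - ∑ g, η f g)
      + ∑ f, ∑ g : P.cmp f, (P.maxRegret f P.σ (θ f) - ⟪P.expRegret g P.σ, θ f⟫) * η f g
      + ∑ f, ∑ g : P.cmp f, η f g * ⟪P.expRegret g P.σ, θ f⟫
      = ∑ f, P.maxRegret f P.σ (θ f) := by
    rw [← Finset.sum_add_distrib, ← Finset.sum_add_distrib]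
    refine Finset.sum_congr rfl fun f _ => ?_
    simp only [sub_mul, Finset.sum_sub_distrib, ← Finset.mul_sum]
    simp only [mul_comm]
    ring
  rw [lagrangian_eq, partialLagrangian_eq, dualObjective]
  simp only [optimalMultipliers, sub_self, inner_zero_right, Finset.sum_const_zero, Pi.zero_apply,
    zero_mul]
  rw [h1] at key
  simp only [shannonEntropy]
  linarith

/-! ### Non-smoothness of the dual objective -/

theorem differentiable_inner_apply (v : V) (f : Φ) :
    Differentiable ℝ fun θ : Φ → V => ⟪v, θ f⟫ :=
  (differentiable_const v).inner ℝ (differentiable_apply f)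

theorem differentiable_log_Z (P : ICEProblem ι A V Φ) :
    Differentiable ℝ fun θ => Real.log (P.Z θ) := by
  have := P.nonempty_action
  have h : Differentiable ℝ P.Z := by
    unfold Z score
    exact Differentiable.fun_sum fun a _ => (Differentiable.fun_sum fun f _ =>
      differentiable_inner_apply (P.r f a) f).fun_neg.exp
  exact h.log fun θ => (sum_exp_neg_pos (P.score θ)).ne'

theorem maxRegret_smul (P : ICEProblem ι A V Φ) (f : Φ) (p : (∀ i, A i) → ℝ) (w : V) {t : ℝ}
    (ht : 0 ≤ t) : P.maxRegret f p (t • w) = t * P.maxRegret f p w := by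
  simp only [maxRegret, real_inner_smul_right]
  exact (Finset.mul₀_sup' ht _ _ _).symm

/-- A positively homogeneous function that is differentiable at `0` is linear. -/
theorem add_neg_eq_zero_of_differentiableAt_zero {E : Type*} [NormedAddCommGroup E]
    [NormedSpace ℝ E] {h : E → ℝ} (hh : ∀ (t : ℝ) w, 0 ≤ t → h (t • w) = t * h w)
    (hd : DifferentiableAt ℝ h 0) (w : E) : h w + h (-w) = 0 := by
  have key : ∀ w, h w = fderiv ℝ h 0 w := by
    intro w
    have hc : HasDerivAt (fun t : ℝ => t • w) w 0 := by
      simpa using (hasDerivAt_id (0 : ℝ)).smul_const w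
    have hf : HasFDerivAt h (fderiv ℝ h 0) ((0 : ℝ) • w) := by
      rw [zero_smul]
      exact hd.hasFDerivAt
    -- Homogeneity is known only for `t ≥ 0`, so one-sided derivatives are compared.
    have h1 := (hf.comp_hasDerivAt (0 : ℝ) hc).hasDerivWithinAt (s := Set.Ici 0)
    have h2 : HasDerivWithinAt (fun t : ℝ => t * h w) (h w) (Set.Ici 0) 0 := by
      simpa using ((hasDerivAt_id (0 : ℝ)).mul_const (h w)).hasDerivWithinAt
    have h3 : HasDerivWithinAt (fun t : ℝ => t * h w) (fderiv ℝ h 0 w) (Set.Ici 0) 0 :=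
      h1.congr (fun t ht => (hh t w ht).symm) (hh 0 w le_rfl).symm
    exact (uniqueDiffOn_Ici (0 : ℝ) 0 Set.self_mem_Ici).eq_deriv _ h2 h3
  rw [key, key (-w), map_neg, add_neg_cancel]

theorem not_differentiableAt_dualObjective_zero (P : ICEProblem ι A V Φ) {f g g' : Φ}
    (hg : g ∈ P.cmp f) (hg' : g' ∈ P.cmp f)
    (hne : P.expRegret g P.σ ≠ P.expRegret g' P.σ) :
    ¬ DifferentiableAt ℝ P.dualObjective 0 := by
  classical
  intro hd
  have hR : DifferentiableAt ℝ (fun θ : Φ → V => ∑ f, P.maxRegret f P.σ (θ f)) 0 := by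
    refine (hd.sub (P.differentiable_log_Z 0)).congr_of_eventuallyEq
      (Filter.Eventually.of_forall fun θ => ?_)
    simp [dualObjective]
  -- In this direction the regrets at `w` and `-w` sum to at least `⟪w, w⟫ > 0`, whereas linearity
  -- would give `0`.
  set w := P.expRegret g P.σ - P.expRegret g' P.σ with hw
  have hlin := add_neg_eq_zero_of_differentiableAt_zero (fun t θ ht => by
    simp only [Pi.smul_apply, P.maxRegret_smul _ _ _ ht, Finset.mul_sum]) hR (Pi.single f w)
  have hzero : ∀ f', P.maxRegret f' P.σ 0 = 0 := fun f' => by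
    simpa using P.maxRegret_smul f' P.σ (0 : V) (le_refl (0 : ℝ))
  rw [← Pi.single_neg, Finset.sum_eq_single f (fun b _ hb => by simp [hb, hzero]) (by simp),
    Finset.sum_eq_single f (fun b _ hb => by simp [hb, hzero]) (by simp), Pi.single_eq_same,
    Pi.single_eq_same] at hlin
  have h1 : ⟪P.expRegret g P.σ, w⟫ ≤ P.maxRegret f P.σ w :=
    Finset.le_sup' (fun g => ⟪P.expRegret g P.σ, w⟫) hg
  have h2 : ⟪P.expRegret g' P.σ, -w⟫ ≤ P.maxRegret f P.σ (-w) :=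
    Finset.le_sup' (fun g => ⟪P.expRegret g P.σ, -w⟫) hg'
  have hpos : 0 < ⟪w, w⟫ := real_inner_self_pos.2 (sub_ne_zero.2 hne)
  rw [inner_neg_right] at h2
  have h3 : ⟪w, w⟫ = ⟪P.expRegret g P.σ, w⟫ - ⟪P.expRegret g' P.σ, w⟫ := by
    conv_lhs => rw [hw, inner_sub_left]
  linarith

theorem differentiable_dualObjective (P : ICEProblem ι A V Φ)
    (h : ∀ f, ∀ g ∈ P.cmp f, ∀ g' ∈ P.cmp f, P.expRegret g P.σ = P.expRegret g' P.σ) :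
    Differentiable ℝ P.dualObjective := by
  choose g hg using P.cmp_nonempty
  have : P.dualObjective =
      fun θ => ∑ f, ⟪P.expRegret (g f) P.σ, θ f⟫ + Real.log (P.Z θ) := by
    funext θ
    rw [dualObjective]
    congr 1
    refine Finset.sum_congr rfl fun f _ => ?_
    rw [maxRegret, Finset.sup'_congr (P.cmp_nonempty f) rfl
      (g := fun _ => ⟪P.expRegret (g f) P.σ, θ f⟫) (fun g' hg' => by rw [h f g' hg' _ (hg f)]),
      Finset.sup'_const]
  rw [this]
  exact (Differentiable.fun_sum fun f _ => differentiable_inner_apply _ f).add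
    P.differentiable_log_Z

theorem not_differentiable_dualObjective_iff (P : ICEProblem ι A V Φ) :
    ¬ Differentiable ℝ P.dualObjective ↔
      ∃ f, ∃ g ∈ P.cmp f, ∃ g' ∈ P.cmp f, P.expRegret g P.σ ≠ P.expRegret g' P.σ := by
  refine ⟨fun h => ?_, fun ⟨f, g, hg, g', hg', hne⟩ hd =>
    P.not_differentiableAt_dualObjective_zero hg hg' hne (hd 0)⟩
  by_contra! h'
  exact h (P.differentiable_dualObjective h')

/-- One player with two actions of utility `0` and `1` who always plays the first; the deviations
are the identity and the swap. -/
def identityOrSwap : ICEProblem (Fin 1) (fun _ => Fin 2) ℝ (Fin 2) where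
  game := ⟨fun _ a => ((a 0 : ℕ) : ℝ)⟩
  -- Addition in `Fin 2` is modulo 2.
  dev f := .unilateral 0 fun b => b + f
  cmp _ := Finset.univ
  cmp_nonempty _ := Finset.univ_nonempty
  σ := Pi.single 0 1
  σ_mem := single_mem_stdSimplex ℝ _
  K := Set.univ

theorem expRegret_identityOrSwap (f : Fin 2) :
    identityOrSwap.expRegret f identityOrSwap.σ = ((f : ℕ) : ℝ) := by
  rw [expRegret, Finset.sum_eq_single 0]
  · simp [identityOrSwap, r, Deviation.regret]
  · intro a _ ha
    simp [identityOrSwap, ha]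
  · simp

theorem not_differentiableAt_identityOrSwap :
    ¬ DifferentiableAt ℝ identityOrSwap.dualObjective 0 := by
  refine identityOrSwap.not_differentiableAt_dualObjective_zero (f := 0) (g := 0) (g' := 1)
    (Finset.mem_univ _) (Finset.mem_univ _) ?_
  simp [expRegret_identityOrSwap]

/-! ### Cones and convexity of the dual feasible set. -/

variable [CompleteSpace V]

theorem mem_dualCone {P : ICEProblem ι A V Φ} {y : V} :
    y ∈ P.dualCone ↔ ∀ x ∈ P.K, 0 ≤ ⟪x, y⟫ := Iff.rfl

theorem mem_bidualCone {P : ICEProblem ι A V Φ} {y : V} :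
    y ∈ P.bidualCone ↔ ∀ x ∈ P.dualCone, 0 ≤ ⟪x, y⟫ := Iff.rfl

theorem zero_mem_dualFeasible (P : ICEProblem ι A V Φ) : (0 : Φ → V) ∈ P.dualFeasible :=
  fun _ => mem_bidualCone.2 fun x _ => by simp

theorem convex_dualFeasible (P : ICEProblem ι A V Φ) : Convex ℝ P.dualFeasible := by
  refine fun θ hθ θ' hθ' s t hs ht _ f => mem_bidualCone.2 fun x hx => ?_
  rw [Pi.add_apply, Pi.smul_apply, Pi.smul_apply, inner_add_right, real_inner_smul_right,
    real_inner_smul_right]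
  exact add_nonneg (mul_nonneg hs (mem_bidualCone.1 (hθ f) x hx))
    (mul_nonneg ht (mem_bidualCone.1 (hθ' f) x hx))

theorem convexOn_dualObjective (P : ICEProblem ι A V Φ) :
    ConvexOn ℝ P.dualFeasible P.dualObjective :=
  P.convexOn_dualObjective_univ.subset (Set.subset_univ _) P.convex_dualFeasible

/-! ### The primal program -/

theorem mem_primalFeasible {P : ICEProblem ι A V Φ}
    {x : ((∀ i, A i) → ℝ) × (∀ f, P.cmp f → ℝ)} :
    x ∈ P.primalFeasible ↔ x ∈ P.strategies ∧ ∀ f, -P.violation x f ∈ P.dualCone := by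
  rw [mem_strategies, and_assoc]
  rfl

theorem isClosed_dualCone (P : ICEProblem ι A V Φ) : IsClosed P.dualCone :=
  (ProperCone.innerDual P.K).isClosed

theorem isCompact_primalFeasible (P : ICEProblem ι A V Φ) : IsCompact P.primalFeasible := by
  have : P.primalFeasible = P.strategies ∩ ⋂ f, {x | -P.violation x f ∈ P.dualCone} := by
    ext x
    simp [mem_primalFeasible]
  rw [this]
  exact P.isCompact_strategies.inter_right (isClosed_iInter fun f =>
    P.isClosed_dualCone.preimage (P.continuous_violation f).neg)

theorem convex_primalFeasible (P : ICEProblem ι A V Φ) : Convex ℝ P.primalFeasible := by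
  intro x hx y hy s t hs ht hst
  rw [mem_primalFeasible] at hx hy ⊢
  refine ⟨P.convex_strategies hx.1 hy.1 hs ht hst, fun f => mem_dualCone.2 fun k hk => ?_⟩
  have h1 := mem_dualCone.1 (hx.2 f) k hk
  have h2 := mem_dualCone.1 (hy.2 f) k hk
  rw [inner_neg_right] at h1 h2 ⊢
  rw [violation_combo, inner_add_right, real_inner_smul_right, real_inner_smul_right]
  nlinarith

/-- The true behavior, with each `η_f` the point mass at `f`, has zero violation. -/
theorem primalFeasible_nonempty (P : ICEProblem ι A V Φ) (h : ∀ f, f ∈ P.cmp f) :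
    P.primalFeasible.Nonempty := by
  classical
  refine ⟨(P.σ, fun f => Pi.single ⟨f, h f⟩ 1), mem_primalFeasible.2
    ⟨mem_strategies.2 ⟨P.σ_mem, fun f => single_mem_stdSimplex ℝ _⟩, fun f => ?_⟩⟩
  have : P.comparison f (Pi.single ⟨f, h f⟩ 1) = P.expRegret f P.σ := by
    rw [comparison, Finset.sum_eq_single ⟨f, h f⟩]
    · simp
    · intro b _ hb
      simp [hb]
    · simp
  simp [violation, this, mem_dualCone]

/-- Existence is by compactness. The entropy is strictly concave in `p` but ignores `η`, so only `p`
is unique: the midpoint of two optima with different `p` would have larger entropy. -/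
theorem existsUnique_isMaxEnt (P : ICEProblem ι A V Φ) (h : P.primalFeasible.Nonempty) :
    ∃! p, P.IsMaxEnt p := by
  obtain ⟨x, hx, hmax⟩ := P.isCompact_primalFeasible.exists_isMaxOn h
    (continuous_shannonEntropy.comp continuous_fst).continuousOn
  refine ⟨x.1, ⟨x.2, hx, fun y hy => hmax hy⟩, fun q hq => ?_⟩
  obtain ⟨η, hqη, hqmax⟩ := hq
  by_contra hne
  have hp0 := (mem_strategies.1 (mem_primalFeasible.1 hx).1).1.1
  have hq0 := (mem_strategies.1 (mem_primalFeasible.1 hqη).1).1.1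
  have hmid := P.convex_primalFeasible hqη hx
    (by norm_num : (0 : ℝ) ≤ 1 / 2) (by norm_num : (0 : ℝ) ≤ 1 / 2) (by norm_num)
  have hlt := strictConcaveOn_shannonEntropy.2 hq0 hp0 hne
    (by norm_num : (0 : ℝ) < 1 / 2) (by norm_num : (0 : ℝ) < 1 / 2) (by norm_num)
  have h1 := hqmax _ hmid
  have h2 := hqmax x hx
  have h3 : shannonEntropy q ≤ shannonEntropy x.1 := hmax hqη
  simp only [Prod.fst_add, Prod.smul_fst, smul_eq_mul] at h1 hlt
  linarith

/-! ### Duality -/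

theorem entropy_le_partialLagrangian (P : ICEProblem ι A V Φ)
    {x : ((∀ i, A i) → ℝ) × (∀ f, P.cmp f → ℝ)} (hx : x ∈ P.primalFeasible) {θ : Φ → V}
    (hθ : θ ∈ P.dualFeasible) : shannonEntropy x.1 ≤ P.partialLagrangian x θ := by
  have : ∑ f, ⟪P.violation x f, θ f⟫ ≤ 0 := Finset.sum_nonpos fun f _ => by
    have := mem_bidualCone.1 (hθ f) _ ((mem_primalFeasible.1 hx).2 f)
    rw [inner_neg_left] at this
    linarith
  rw [partialLagrangian]
  linarith

/-- At a point that violates a constraint the partial Lagrangian is unbounded below in `θ`. -/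
theorem exists_partialLagrangian_lt (P : ICEProblem ι A V Φ)
    {x : ((∀ i, A i) → ℝ) × (∀ f, P.cmp f → ℝ)} (hx : x ∈ P.strategies)
    (hx' : x ∉ P.primalFeasible) (c : ℝ) :
    ∃ θ ∈ P.dualFeasible, P.partialLagrangian x θ < c := by
  classical
  rw [mem_primalFeasible] at hx'
  push Not at hx'
  obtain ⟨f, hf⟩ := hx' hx
  rw [mem_dualCone] at hf
  push Not at hf
  obtain ⟨k, hk, hneg⟩ := hf
  rw [inner_neg_right, neg_lt_zero, real_inner_comm] at hneg
  -- Since `k ∈ K ⊆ K**`, every price `n • k` is feasible; it lowers the Lagrangian by `n` times a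
  -- positive number.
  obtain ⟨n, hn⟩ := exists_nat_gt ((shannonEntropy x.1 - c) / ⟪P.violation x f, k⟫)
  rw [div_lt_iff₀ hneg] at hn
  refine ⟨Pi.single f ((n : ℝ) • k), fun f' => mem_bidualCone.2 fun y hy => ?_, ?_⟩
  · rcases eq_or_ne f' f with rfl | hne
    · rw [Pi.single_eq_same, real_inner_smul_right, real_inner_comm]
      exact mul_nonneg n.cast_nonneg (mem_dualCone.1 hy k hk)
    · simp [hne]
  · rw [partialLagrangian, Finset.sum_eq_single f, Pi.single_eq_same, real_inner_smul_right]
    · linarith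
    · intro b _ hb
      simp [hb]
    · simp

theorem primalValue_le_dualValue (P : ICEProblem ι A V Φ) : P.primalValue ≤ P.dualValue :=
  iSup₂_le fun _ hx => le_iInf₂ fun θ hθ => EReal.coe_le_coe_iff.2
    ((P.entropy_le_partialLagrangian hx hθ).trans
      (P.partialLagrangian_le (mem_primalFeasible.1 hx).1 θ))

/-- Sion's theorem for `-L`, which is convex on the compact set of strategies and affine in `θ`.
Values in `EReal` allow the supremum over the unbounded set of prices to be `⊤`. -/
theorem minimax_partialLagrangian (P : ICEProblem ι A V Φ) :
    (⨅ x ∈ P.strategies, ⨆ θ ∈ P.dualFeasible, ((-P.partialLagrangian x θ : ℝ) : EReal))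
      = ⨆ θ ∈ P.dualFeasible, ⨅ x ∈ P.strategies, ((-P.partialLagrangian x θ : ℝ) : EReal) := by
  have mono : Monotone Real.toEReal := EReal.coe_strictMono.monotone
  have hconvex (θ : Φ → V) : QuasiconvexOn ℝ P.strategies fun x => -P.partialLagrangian x θ :=
    (P.concaveOn_partialLagrangian_left θ).neg.quasiconvexOn
  have hconcave (x) : QuasiconcaveOn ℝ P.dualFeasible fun θ => -P.partialLagrangian x θ :=
    ConcaveOn.quasiconcaveOn ⟨P.convex_dualFeasible, fun θ _ θ' _ s t _ _ hst => by
      have := P.partialLagrangian_combo x θ θ' hst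
      simp only [smul_eq_mul]
      linarith⟩
  exact Sion.minimax' P.strategies_nonempty P.convex_strategies P.isCompact_strategies
    (fun θ _ => (continuous_coe_real_ereal.comp
      (P.continuous_partialLagrangian_left θ).neg).lowerSemicontinuous.lowerSemicontinuousOn _)
    (fun θ _ => QuasiconvexOn.monotone_comp (g := Real.toEReal) mono (hconvex θ))
    P.convex_dualFeasible
    (fun x _ => (continuous_coe_real_ereal.comp
      (P.continuous_partialLagrangian_right x).neg).upperSemicontinuous.upperSemicontinuousOn _)
    (fun x _ => QuasiconcaveOn.monotone_comp (g := Real.toEReal) mono (hconcave x))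

/-- A gap would contain reals `c < d`. Maximizing `L` over `x` first gives at least `d` for every
`θ`, while every `x` has a price with `L ≤ c`, contradicting the minimax equality. -/
theorem dualValue_le_primalValue (P : ICEProblem ι A V Φ) : P.dualValue ≤ P.primalValue := by
  by_contra! hlt
  obtain ⟨c, hc, hc'⟩ := EReal.lt_iff_exists_real_btwn.1 hlt
  obtain ⟨d, hd, hd'⟩ := EReal.lt_iff_exists_real_btwn.1 hc'
  have hupper : (⨆ θ ∈ P.dualFeasible, ⨅ x ∈ P.strategies,
      ((-P.partialLagrangian x θ : ℝ) : EReal)) ≤ ((-d : ℝ) : EReal) := by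
    refine iSup₂_le fun θ hθ => ?_
    obtain ⟨x, hx, h⟩ := P.exists_partialLagrangian_eq θ
    refine (iInf₂_le x hx).trans (EReal.coe_le_coe_iff.2 (neg_le_neg ?_))
    rw [h]
    exact EReal.coe_le_coe_iff.1 (hd'.le.trans (iInf₂_le θ hθ))
  have hlower : ((-c : ℝ) : EReal) ≤ ⨅ x ∈ P.strategies, ⨆ θ ∈ P.dualFeasible,
      ((-P.partialLagrangian x θ : ℝ) : EReal) := by
    refine le_iInf₂ fun x hx => ?_
    obtain ⟨θ, hθ, h⟩ : ∃ θ ∈ P.dualFeasible, P.partialLagrangian x θ ≤ c := by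
      by_cases hxf : x ∈ P.primalFeasible
      · refine ⟨0, P.zero_mem_dualFeasible, ?_⟩
        have : ((shannonEntropy x.1 : ℝ) : EReal) ≤ c :=
          (le_iSup₂ (f := fun x (_ : x ∈ P.primalFeasible) =>
            ((shannonEntropy x.1 : ℝ) : EReal)) x hxf).trans hc.le
        simpa [partialLagrangian] using EReal.coe_le_coe_iff.1 this
      · obtain ⟨θ, hθ, h⟩ := P.exists_partialLagrangian_lt hx hxf c
        exact ⟨θ, hθ, h.le⟩
    exact (EReal.coe_le_coe_iff.2 (neg_le_neg h)).trans
      (le_iSup₂ (f := fun θ (_ : θ ∈ P.dualFeasible) =>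
        ((-P.partialLagrangian x θ : ℝ) : EReal)) θ hθ)
  rw [P.minimax_partialLagrangian] at hlower
  have := EReal.coe_le_coe_iff.1 (hlower.trans hupper)
  have := EReal.coe_lt_coe_iff.1 hd
  linarith

theorem primalValue_eq_dualValue (P : ICEProblem ι A V Φ) : P.primalValue = P.dualValue :=
  le_antisymm P.primalValue_le_dualValue P.dualValue_le_primalValue

/-- Strong duality closes the chain `D(θ) ≤ H(p) ≤ L ≤ D(θ)`, so the equality case of Gibbs applies.
-/
theorem IsMaxEnt.eq_gibbs {P : ICEProblem ι A V Φ} {p : (∀ i, A i) → ℝ} (hp : P.IsMaxEnt p)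
    {θ : Φ → V} (hθ : P.IsDualOptimal θ) : p = gibbs (P.score θ) := by
  obtain ⟨η, hfeas, hmax⟩ := hp
  have hdual : ((P.dualObjective θ : ℝ) : EReal) ≤ P.dualValue :=
    le_iInf₂ fun θ' hθ' => EReal.coe_le_coe_iff.2 (hθ.2 θ' hθ')
  have hprimal : P.primalValue ≤ ((shannonEntropy p : ℝ) : EReal) :=
    iSup₂_le fun x hx => EReal.coe_le_coe_iff.2 (hmax x hx)
  have hle : P.dualObjective θ ≤ shannonEntropy p := EReal.coe_le_coe_iff.1
    (hdual.trans (P.primalValue_eq_dualValue ▸ hprimal))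
  exact P.eq_gibbs_of_dualObjective_le (mem_primalFeasible.1 hfeas).1
    (hle.trans (P.entropy_le_partialLagrangian hfeas hθ.1))

/-- A dual optimum makes the common value finite, so recovery needs no separate feasibility
hypothesis. -/
theorem IsDualOptimal.primalFeasible_nonempty {P : ICEProblem ι A V Φ} {θ : Φ → V}
    (hθ : P.IsDualOptimal θ) : P.primalFeasible.Nonempty := by
  by_contra h
  have hbot : P.primalValue = ⊥ := by
    rw [primalValue, Set.not_nonempty_iff_eq_empty.1 h]
    simp
  have hdual : ((P.dualObjective θ : ℝ) : EReal) ≤ P.dualValue :=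
    le_iInf₂ fun θ' hθ' => EReal.coe_le_coe_iff.2 (hθ.2 θ' hθ')
  rw [← P.primalValue_eq_dualValue, hbot] at hdual
  exact EReal.coe_ne_bot _ (le_bot_iff.1 hdual)

theorem IsDualOptimal.isMaxEnt_iff {P : ICEProblem ι A V Φ} {θ : Φ → V}
    (hθ : P.IsDualOptimal θ) (p : (∀ i, A i) → ℝ) :
    P.IsMaxEnt p ↔ ∀ a, p a = Real.exp (-P.score θ a) / P.Z θ := by
  refine ⟨fun hp a => congrFun (hp.eq_gibbs hθ) a, fun h => ?_⟩
  obtain ⟨q, hq, -⟩ := P.existsUnique_isMaxEnt hθ.primalFeasible_nonempty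
  have : p = q := (funext h : p = gibbs (P.score θ)).trans (hq.eq_gibbs hθ).symm
  exact this ▸ hq

/-! ### The Lagrange dual function -/

/-- Test the supremum at the maximizer of the partial Lagrangian with `y = 0`: the equality terms
vanish and the `u`, `v` terms are nonnegative. -/
theorem dualObjective_le_lagrangeDual (P : ICEProblem ι A V Φ) {m : P.Multipliers}
    (hm : m.Admissible) : ((P.dualObjective m.θ : ℝ) : EReal) ≤ P.lagrangeDual m := by
  obtain ⟨⟨p, η⟩, hx, h⟩ := P.exists_partialLagrangian_eq m.θ
  obtain ⟨hp, hη⟩ := mem_strategies.1 hx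
  refine le_trans (EReal.coe_le_coe_iff.2 ?_) (P.lagrangian_le_lagrangeDual hp.1 η 0 m)
  have h1 : ∑ f, m.α f * (1 - ∑ g, η f g) = 0 :=
    Finset.sum_eq_zero fun f _ => by rw [(hη f).2, sub_self, mul_zero]
  have h2 : 0 ≤ ∑ f, ∑ g, m.v f g * η f g := Finset.sum_nonneg fun f _ =>
    Finset.sum_nonneg fun g _ => mul_nonneg (hm.2.1 f g) ((hη f).1 g)
  have h3 : 0 ≤ ∑ a, m.u a * p a := Finset.sum_nonneg fun a _ => mul_nonneg (hm.1 a) (hp.1 a)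
  have h4 : ∑ a, p a = 1 := hp.2
  rw [lagrangian_eq, h, h1, h4]
  simp only [Pi.zero_apply, inner_zero_left, Finset.sum_const_zero]
  linarith

theorem optimalMultipliers_admissible (P : ICEProblem ι A V Φ) {θ : Φ → V}
    (hθ : θ ∈ P.dualFeasible) : (P.optimalMultipliers θ).Admissible :=
  ⟨fun _ => le_rfl, fun f g => sub_nonneg.2
    (Finset.le_sup' (fun g => ⟪P.expRegret g P.σ, θ f⟫) g.2), hθ⟩

theorem lagrangeDual_optimalMultipliers (P : ICEProblem ι A V Φ) {θ : Φ → V}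
    (hθ : θ ∈ P.dualFeasible) :
    P.lagrangeDual (P.optimalMultipliers θ) = ((P.dualObjective θ : ℝ) : EReal) := by
  have hge := P.dualObjective_le_lagrangeDual (P.optimalMultipliers_admissible hθ)
  rw [show (P.optimalMultipliers θ).θ = θ from rfl] at hge
  refine le_antisymm ?_ hge
  rw [lagrangeDual]
  exact iSup_le fun p => iSup_le fun hp => iSup_le fun η => iSup_le fun y =>
    EReal.coe_le_coe_iff.2 (P.lagrangian_optimalMultipliers_le θ hp η y)

theorem isLeast_lagrangeDual (P : ICEProblem ι A V Φ) {θ : Φ → V} (hθ : θ ∈ P.dualFeasible) :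
    IsLeast {d : EReal | ∃ m : P.Multipliers, m.θ = θ ∧ m.Admissible ∧ d = P.lagrangeDual m}
      ((P.dualObjective θ : ℝ) : EReal) := by
  refine ⟨⟨P.optimalMultipliers θ, rfl, P.optimalMultipliers_admissible hθ,
    (P.lagrangeDual_optimalMultipliers hθ).symm⟩, ?_⟩
  rintro _ ⟨m, hmθ, hm, hd⟩
  rw [hd, ← hmθ]
  exact P.dualObjective_le_lagrangeDual hm

/-- As `m.x` lies in `K**` and `m.θ` does not, they differ at some `f`; the Lagrangian is then a
nonconstant affine function of the free `y_f`. -/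
theorem lagrangeDual_eq_top (P : ICEProblem ι A V Φ) {m : P.Multipliers} (hm : m.Admissible)
    (hθ : m.θ ∉ P.dualFeasible) : P.lagrangeDual m = ⊤ := by
  classical
  obtain ⟨f, hf⟩ : ∃ f, m.x f - m.θ f ≠ 0 := by
    by_contra! h
    exact hθ fun f => sub_eq_zero.1 (h f) ▸ hm.2.2 f
  have hpos : 0 < ⟪m.x f - m.θ f, m.x f - m.θ f⟫ := real_inner_self_pos.2 hf
  refine EReal.eq_top_iff_forall_lt _ |>.2 fun c => ?_
  obtain ⟨t, ht⟩ := exists_gt ((c - P.lagrangian 0 0 0 m) / ⟪m.x f - m.θ f, m.x f - m.θ f⟫)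
  rw [div_lt_iff₀ hpos] at ht
  refine lt_of_lt_of_le (EReal.coe_lt_coe_iff.2 ?_) (P.lagrangian_le_lagrangeDual (p := 0)
    (fun _ => le_rfl) 0 (Pi.single f (t • (m.x f - m.θ f))) m)
  have h : ∑ f', ⟪Pi.single (M := fun _ => V) f (t • (m.x f - m.θ f)) f', m.x f' - m.θ f'⟫
      = t * ⟪m.x f - m.θ f, m.x f - m.θ f⟫ := by
    rw [Finset.sum_eq_single f, Pi.single_eq_same, real_inner_smul_left]
    · intro b _ hb
      simp [hb]
    · simp
  rw [lagrangian_eq] at ht ⊢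
  rw [h]
  simp only [Pi.zero_apply, inner_zero_left, Finset.sum_const_zero] at ht ⊢
  linarith

end ICEProblem

end

theorem mainTheorem3 {ι : Type*} [Fintype ι] [DecidableEq ι] {A : ι → Type*}
    [∀ i, Fintype (A i)] {V : Type*} [NormedAddCommGroup V] [InnerProductSpace ℝ V] [CompleteSpace V]
    {Φ : Type*} [Fintype Φ] (P : ICEProblem ι A V Φ) :
    -- Lagrange dual: minimizing the dual function over the multipliers other than `θ` gives the
    -- dual objective for `θ_f ∈ K**`, with the minimum attained, and `+∞` for all other `θ`.
    ((∀ θ ∈ P.dualFeasible,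
        IsLeast {d : EReal | ∃ m : P.Multipliers, m.θ = θ ∧ m.Admissible ∧ d = P.lagrangeDual m}
          ((P.dualObjective θ : ℝ) : EReal)) ∧
      (∀ θ, θ ∉ P.dualFeasible →
        ∀ m : P.Multipliers, m.θ = θ → m.Admissible → P.lagrangeDual m = ⊤)) ∧
    -- The dual program is convex.
    (Convex ℝ P.dualFeasible ∧ ConvexOn ℝ P.dualFeasible P.dualObjective) ∧
    -- It is non-smooth: exactly when some `Φ_f` holds two deviations with different expected
    -- regret features, and then at the feasible point `0`; this occurs for `K = V`, `Φ_f = Φ`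
    -- and ordinary deviations of a player.
    ((0 : Φ → V) ∈ P.dualFeasible ∧
      (¬ Differentiable ℝ P.dualObjective ↔
        ∃ f, ∃ g ∈ P.cmp f, ∃ g' ∈ P.cmp f, P.expRegret g P.σ ≠ P.expRegret g' P.σ) ∧
      (¬ Differentiable ℝ P.dualObjective → ¬ DifferentiableAt ℝ P.dualObjective 0) ∧
      (∃ Q : ICEProblem (Fin 1) (fun _ => Fin 2) ℝ (Fin 2),
        Q.K = Set.univ ∧ (∀ f, Q.cmp f = Finset.univ) ∧
        (∀ f, ∃ i φ, Q.dev f = Deviation.unilateral i φ) ∧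
        ∃ θ ∈ Q.dualFeasible, ¬ DifferentiableAt ℝ Q.dualObjective θ)) ∧
    -- Strong duality, and existence and uniqueness of the maximum entropy ICE distribution.
    (P.primalValue = P.dualValue ∧
      ((∀ f, f ∈ P.cmp f) → P.primalFeasible.Nonempty) ∧
      (P.primalFeasible.Nonempty → ∃! p, P.IsMaxEnt p)) ∧
    -- Recovery of the maximum entropy ICE distribution from optimal dual weights.
    (∀ θ, P.IsDualOptimal θ → ∀ p,
      P.IsMaxEnt p ↔ ∀ a, p a = Real.exp (-P.score θ a) / P.Z θ) := by
  refine ⟨⟨fun θ hθ => P.isLeast_lagrangeDual hθ, fun θ hθ m hm hadm =>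
      P.lagrangeDual_eq_top hadm (hm ▸ hθ)⟩,
    ⟨P.convex_dualFeasible, P.convexOn_dualObjective⟩,
    ⟨P.zero_mem_dualFeasible, P.not_differentiable_dualObjective_iff, fun h => ?_, ?_⟩,
    ⟨P.primalValue_eq_dualValue, P.primalFeasible_nonempty, P.existsUnique_isMaxEnt⟩,
    fun θ hθ p => hθ.isMaxEnt_iff p⟩
  · obtain ⟨f, g, hg, g', hg', hne⟩ := P.not_differentiable_dualObjective_iff.1 h
    exact P.not_differentiableAt_dualObjective_zero hg hg' hne
  · exact ⟨ICEProblem.identityOrSwap, rfl, fun _ => rfl, fun f => ⟨0, _, rfl⟩, 0,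
      ICEProblem.zero_mem_dualFeasible _, ICEProblem.not_differentiableAt_identityOrSwap⟩
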